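/- Let $Q$ be a regular local ring of dimension $n$, let $I$ be a proper ideal of $Q$, put $R=Q/I$ and $t=\operatorname{depth}R$, and let $\operatorname{mod}R$ be the category of finitely generated $R$-modules. For $M\in\operatorname{mod}R$ put $$\mathbb{T}(M)=\operatorname{Tor}^Q_{n-t}(R,M),\qquad \mathbb{E}(M)=\operatorname{Ext}_Q^{n-t}(R,M),\qquad E=\operatorname{Ext}_Q^{n-t}(R,Q),$$ which are finitely generated $R$-modules; $\mathbb{T}$ and $\mathbb{E}$ are covariant functors from $\operatorname{mod}R$ to $\operatorname{mod}R$. Then there are isomorphisms of functors from $\operatorname{mod}R$ to $\operatorname{mod}R$ $$\mathbb{T}(-)\cong\operatorname{Hom}_R(E,-),\qquad \mathbb{E}(-)\cong E\otimes_R-.$$ In particular, $\mathbb{E}$ is left adjoint to $\mathbb{T}$ on $\operatorname{mod}R$, and there is an $R$-module isomorphism $\mathbb{E}(R)\cong E$. -/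

import Mathlib

open CategoryTheory

universe u

/-- The depth of a (noetherian) local ring `R`: the supremum of the lengths of the `R`-regular
sequences contained in the maximal ideal. -/
noncomputable def localDepth (R : Type u) [CommRing R] [IsLocalRing R] : ℕ∞ :=
  ⨆ rs : {rs : List R // (∀ r ∈ rs, r ∈ IsLocalRing.maximalIdeal R) ∧
    RingTheory.Sequence.IsRegular R rs}, (rs.1.length : ℕ∞)

section Finiteness

variable {Q : Type u} [CommRing Q]

theorem fgModuleCat_epi_iff_surjective [IsNoetherianRing Q] {M N : FGModuleCat.{u} Q}
    (f : M ⟶ N) : Epi f ↔ Function.Surjective f.hom.hom := by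
  constructor
  · intro h
    have : Epi ((forget₂ (FGModuleCat.{u} Q) (ModuleCat.{u} Q)).map f) := inferInstance
    exact (ModuleCat.epi_iff_surjective _).1 this
  · intro h
    have : Epi ((forget₂ (FGModuleCat.{u} Q) (ModuleCat.{u} Q)).map f) :=
      (ModuleCat.epi_iff_surjective _).2 h
    exact (forget₂ (FGModuleCat.{u} Q) (ModuleCat.{u} Q)).epi_of_epi_map this

theorem fgModuleCat_projective_of_free [IsNoetherianRing Q] (k : ℕ) :
    Projective (FGModuleCat.of Q (Fin k → Q)) where
  factors {E X} f e he := by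
    obtain ⟨g, hg⟩ := Module.projective_lifting_property e.hom.hom f.hom.hom
      ((fgModuleCat_epi_iff_surjective e).1 he)
    exact ⟨FGModuleCat.ofHom g, FGModuleCat.hom_ext hg⟩

theorem fgModuleCat_enoughProjectives [IsNoetherianRing Q] :
    EnoughProjectives (FGModuleCat.{u} Q) where
  presentation X := by
    obtain ⟨k, f, hf⟩ := Module.Finite.exists_fin' Q X
    exact ⟨{ p := FGModuleCat.of Q (Fin k → Q)
             projective := fgModuleCat_projective_of_free k
             f := FGModuleCat.ofHom f
             epi := (fgModuleCat_epi_iff_surjective _).2 hf }⟩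

theorem fgModuleCat_projective_obj [IsNoetherianRing Q] (P : FGModuleCat.{u} Q)
    (hP : Projective P) : Module.Projective Q P := by
  obtain ⟨k, f, hf⟩ := Module.Finite.exists_fin' Q P
  have : Epi (FGModuleCat.ofHom f : FGModuleCat.of Q (Fin k → Q) ⟶ P) :=
    (fgModuleCat_epi_iff_surjective _).2 hf
  obtain ⟨s, hs⟩ := hP.factors (𝟙 P) (FGModuleCat.ofHom f : FGModuleCat.of Q (Fin k → Q) ⟶ P)
  refine Module.Projective.of_split s.hom.hom f ?_
  exact congrArg (fun g => g.hom.hom) hs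

/-- A finitely generated module over a noetherian ring has a resolution by finitely generated
projective modules. -/
theorem exists_finite_projectiveResolution [IsNoetherianRing Q] (N : ModuleCat.{u} Q)
    [hN : Module.Finite Q N] :
    ∃ P : ProjectiveResolution N, ∀ i, Module.Finite Q (P.complex.X i) := by
  have := fgModuleCat_enoughProjectives (Q := Q)
  let F := forget₂ (FGModuleCat.{u} Q) (ModuleCat.{u} Q)
  have : F.PreservesProjectiveObjects := ⟨fun {P} hP => by
    have := fgModuleCat_projective_obj P hP
    exact (IsProjective.iff_projective _).1 this⟩
  have : F.PreservesHomology := inferInstance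
  let P := ProjectiveResolution.of (⟨N, hN⟩ : FGModuleCat.{u} Q)
  exact ⟨F.mapProjectiveResolution P, fun i => (P.complex.X i).property⟩

theorem finite_homology [IsNoetherianRing Q] {ι : Type*} {c : ComplexShape ι}
    (K : HomologicalComplex (ModuleCat.{u} Q) c) (i : ι) (h : Module.Finite Q (K.X i)) :
    Module.Finite Q (K.homology i) := by
  have : Module.Finite Q (K.cycles i) := Module.Finite.of_injective (K.iCycles i).hom
    ((ModuleCat.mono_iff_injective _).1 inferInstance)
  exact Module.Finite.of_surjective (K.homologyπ i).hom
    ((ModuleCat.epi_iff_surjective _).1 inferInstance)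

theorem isTorsionBySet_homology (I : Ideal Q) {ι : Type*} {c : ComplexShape ι}
    (K : HomologicalComplex (ModuleCat.{u} Q) c) (i : ι)
    (h : Module.IsTorsionBySet Q (K.X i) I) : Module.IsTorsionBySet Q (K.homology i) I := by
  intro x a
  obtain ⟨y, rfl⟩ := (ModuleCat.epi_iff_surjective (K.homologyπ i)).1 inferInstance x
  have hy : (a : Q) • y = 0 := by
    apply (ModuleCat.mono_iff_injective (K.iCycles i)).1 inferInstance
    rw [map_smul, map_zero]
    exact @h _ a
  rw [← map_smul, hy, map_zero]

end Finiteness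

section Quotient

variable {Q : Type u} [CommRing Q] (I : Ideal Q)

/-- A finitely generated `Q`-module `N` killed by `I`, regarded as a finitely generated
`Q ⧸ I`-module. The action is the only one that is compatible with that of `Q`:
the class of `a` acts as `a`. -/
noncomputable def toQuotientFG (N : ModuleCat.{u} Q) (hN : Module.IsTorsionBySet Q N I)
    (hfin : Module.Finite Q N) : FGModuleCat.{u} (Q ⧸ I) :=
  letI : Module (Q ⧸ I) N := hN.module
  haveI : IsScalarTower Q (Q ⧸ I) N := hN.isScalarTower
  haveI : Module.Finite (Q ⧸ I) N := Module.Finite.of_restrictScalars_finite Q (Q ⧸ I) N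
  FGModuleCat.of (Q ⧸ I) N

/-- A functor to `Q`-modules whose values are finitely generated and killed by `I`,
regarded as a functor to finitely generated `Q ⧸ I`-modules. -/
noncomputable def liftToQuotientFG {C : Type*} [Category* C] (F : C ⥤ ModuleCat.{u} Q)
    (hF : ∀ X, Module.IsTorsionBySet Q (F.obj X) I) (hfin : ∀ X, Module.Finite Q (F.obj X)) :
    C ⥤ FGModuleCat.{u} (Q ⧸ I) where
  obj X := toQuotientFG I (F.obj X) (hF X) (hfin X)
  map {X Y} f :=
    letI : Module (Q ⧸ I) (F.obj X) := (hF X).module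
    letI : Module (Q ⧸ I) (F.obj Y) := (hF Y).module
    ObjectProperty.homMk (ModuleCat.ofHom
      { toFun := (F.map f).hom
        map_add' := map_add _
        map_smul' := by
          intro r x
          obtain ⟨a, rfl⟩ := Ideal.Quotient.mk_surjective r
          exact map_smul (F.map f).hom a x } :
      (toQuotientFG I (F.obj X) (hF X) (hfin X)).obj ⟶
        (toQuotientFG I (F.obj Y) (hF Y) (hfin Y)).obj)
  map_id X := by
    apply FGModuleCat.hom_ext
    apply LinearMap.ext
    intro x
    have h : (F.map (𝟙 X)).hom x = x := by rw [F.map_id]; rfl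
    exact h
  map_comp {X Y Z} f g := by
    apply FGModuleCat.hom_ext
    apply LinearMap.ext
    intro x
    have h : (F.map (f ≫ g)).hom x = (F.map g).hom ((F.map f).hom x) := by rw [F.map_comp]; rfl
    exact h

/-- Finitely generated `Q ⧸ I`-modules, regarded as `Q`-modules through `Q → Q ⧸ I`. -/
noncomputable abbrev quotientToBase : FGModuleCat.{u} (Q ⧸ I) ⥤ ModuleCat.{u} Q :=
  forget₂ (FGModuleCat.{u} (Q ⧸ I)) (ModuleCat.{u} (Q ⧸ I)) ⋙
    ModuleCat.restrictScalars (Ideal.Quotient.mk I)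

theorem quotientToBase_finite (M : FGModuleCat.{u} (Q ⧸ I)) :
    Module.Finite Q ((quotientToBase I).obj M) := by
  have hM : Module.Finite (Q ⧸ I) M := M.property
  obtain ⟨s, hs⟩ := hM.fg_top
  refine ⟨⟨s, ?_⟩⟩
  rw [eq_top_iff]
  intro x _
  have hx : x ∈ Submodule.span (Q ⧸ I) (s : Set M) := by rw [hs]; trivial
  induction hx using Submodule.span_induction with
  | mem y hy => exact Submodule.subset_span hy
  | zero => exact Submodule.zero_mem _
  | add y z _ _ h1 h2 => exact Submodule.add_mem _ (h1 trivial) (h2 trivial)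
  | smul r y _ h =>
    obtain ⟨a, rfl⟩ := Ideal.Quotient.mk_surjective r
    exact Submodule.smul_mem _ a (h trivial)

theorem quotientToBase_isTorsionBySet (M : FGModuleCat.{u} (Q ⧸ I)) :
    Module.IsTorsionBySet Q ((quotientToBase I).obj M) I := by
  intro x a
  have h : (Ideal.Quotient.mk I (a : Q)) • (show M from x) = 0 := by
    rw [Ideal.Quotient.eq_zero_iff_mem.2 a.2, zero_smul]
  exact h

end Quotient

section Functors

variable {Q : Type u} [CommRing Q] (I : Ideal Q) (d : ℕ)

/-- `M ↦ Tor_d^Q(Q ⧸ I, M)` as a functor from finitely generated `Q ⧸ I`-modules to `Q`-modules;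
`Tor` is computed by projective resolutions of `Q ⧸ I`. -/
noncomputable def torBase : FGModuleCat.{u} (Q ⧸ I) ⥤ ModuleCat.{u} Q :=
  quotientToBase I ⋙ (Tor' (ModuleCat.{u} Q) d).obj (ModuleCat.of Q (Q ⧸ I))

theorem torBase_isTorsionBySet (M : FGModuleCat.{u} (Q ⧸ I)) :
    Module.IsTorsionBySet Q ((torBase I d).obj M) I := by
  let P := ProjectiveResolution.of (ModuleCat.of Q (Q ⧸ I))
  let T := (MonoidalCategory.tensoringRight (ModuleCat.{u} Q)).obj ((quotientToBase I).obj M)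
  let e : (torBase I d).obj M ≅ _ := P.isoLeftDerivedObj T d
  have h : Module.IsTorsionBySet Q
      (((T.mapHomologicalComplex (ComplexShape.down ℕ)).obj P.complex).homology d) I := by
    apply isTorsionBySet_homology
    intro x a
    change TensorProduct Q (P.complex.X d) ((quotientToBase I).obj M) at x
    change (a : Q) • x = 0
    induction x using TensorProduct.induction_on with
    | zero => exact smul_zero _
    | tmul y z =>
      have hz : (a : Q) • z = 0 := @quotientToBase_isTorsionBySet Q _ I M z a
      rw [← TensorProduct.tmul_smul, hz, TensorProduct.tmul_zero]
    | add y z h1 h2 => rw [smul_add, h1, h2, add_zero]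
  intro x a
  apply e.toLinearEquiv.injective
  rw [map_smul, map_zero]
  exact @h _ a

theorem torBase_finite [IsNoetherianRing Q] (M : FGModuleCat.{u} (Q ⧸ I)) :
    Module.Finite Q ((torBase I d).obj M) := by
  obtain ⟨P, hP⟩ := exists_finite_projectiveResolution (ModuleCat.of Q (Q ⧸ I))
  let T := (MonoidalCategory.tensoringRight (ModuleCat.{u} Q)).obj ((quotientToBase I).obj M)
  let e : (torBase I d).obj M ≅ _ := P.isoLeftDerivedObj T d
  have h : Module.Finite Q
      (((T.mapHomologicalComplex (ComplexShape.down ℕ)).obj P.complex).homology d) := by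
    apply finite_homology
    have := hP d
    have := quotientToBase_finite I M
    exact (inferInstance :
      Module.Finite Q (TensorProduct Q (P.complex.X d) ((quotientToBase I).obj M)))
  exact @Module.Finite.equiv _ _ _ _ _ _ _ _ h e.toLinearEquiv.symm

/-- `M ↦ Tor_d^Q(R, M)` as a functor from finitely generated `R`-modules to finitely generated
`R`-modules, where `R = Q ⧸ I`. -/
noncomputable def torFunctor [IsNoetherianRing Q] :
    FGModuleCat.{u} (Q ⧸ I) ⥤ FGModuleCat.{u} (Q ⧸ I) :=
  liftToQuotientFG I (torBase I d) (torBase_isTorsionBySet I d) (torBase_finite I d)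

/-- `N ↦ Ext^d_Q(Q ⧸ I, N)` as a functor from `Q`-modules to `Q`-modules. -/
noncomputable def extBase : ModuleCat.{u} Q ⥤ ModuleCat.{u} Q where
  obj N := ModuleCat.of Q (Abelian.Ext (ModuleCat.of Q (Q ⧸ I)) N d)
  map f := ModuleCat.ofHom
    ((Abelian.Ext.mk₀ f).postcompOfLinear Q (ModuleCat.of Q (Q ⧸ I)) (add_zero d))
  map_id N := by
    ext x
    exact Abelian.Ext.comp_mk₀_id x
  map_comp f g := by
    ext x
    change x.comp (Abelian.Ext.mk₀ (f ≫ g)) (add_zero d) =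
      (x.comp (Abelian.Ext.mk₀ f) (add_zero d)).comp (Abelian.Ext.mk₀ g) (add_zero d)
    rw [Abelian.Ext.comp_assoc_of_third_deg_zero, Abelian.Ext.mk₀_comp_mk₀]

theorem extBase_isTorsionBySet (N : ModuleCat.{u} Q) :
    Module.IsTorsionBySet Q ((extBase I d).obj N) I := by
  intro x a
  change Abelian.Ext (ModuleCat.of Q (Q ⧸ I)) N d at x
  change (a : Q) • x = 0
  have h : (a : Q) • 𝟙 (ModuleCat.of Q (Q ⧸ I)) = 0 := by
    ext
    change (a : Q) • (1 : Q ⧸ I) = 0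
    rw [Algebra.smul_def, mul_one]
    exact Ideal.Quotient.eq_zero_iff_mem.2 a.2
  rw [← Abelian.Ext.mk₀_id_comp x, ← Abelian.Ext.smul_comp, ← Abelian.Ext.mk₀_smul, h,
    Abelian.Ext.mk₀_zero, Abelian.Ext.zero_comp]

theorem extBase_finite [IsNoetherianRing Q] (N : ModuleCat.{u} Q) (hN : Module.Finite Q N) :
    Module.Finite Q ((extBase I d).obj N) :=
  ModuleCat.finite_ext Q (ModuleCat.of Q (Q ⧸ I)) N d

/-- `M ↦ Ext^d_Q(R, M)` as a functor from finitely generated `R`-modules to finitely generated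
`R`-modules, where `R = Q ⧸ I`. -/
noncomputable def extFunctor [IsNoetherianRing Q] :
    FGModuleCat.{u} (Q ⧸ I) ⥤ FGModuleCat.{u} (Q ⧸ I) :=
  liftToQuotientFG I (quotientToBase I ⋙ extBase I d) (fun _ => extBase_isTorsionBySet I d _)
    (fun M => extBase_finite I d _ (quotientToBase_finite I M))

/-- The finitely generated `R`-module `Ext^d_Q(R, Q)`, where `R = Q ⧸ I`. -/
noncomputable def extRing [IsNoetherianRing Q] : FGModuleCat.{u} (Q ⧸ I) :=
  toQuotientFG I ((extBase I d).obj (ModuleCat.of Q Q)) (extBase_isTorsionBySet I d _)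
    (extBase_finite I d _ (inferInstanceAs (Module.Finite Q Q)))

end Functors

/-- The functor `Hom_R(E, -)` on finitely generated modules over a commutative noetherian
ring `R`. -/
noncomputable def homFunctor {R : Type u} [CommRing R] [IsNoetherianRing R]
    (E : FGModuleCat.{u} R) : FGModuleCat.{u} R ⥤ FGModuleCat.{u} R where
  obj M := FGModuleCat.of R (E →ₗ[R] M)
  map f := FGModuleCat.ofHom (LinearMap.compRight R (M := E) f.hom.hom)
  map_id _ := rfl
  map_comp _ _ := rfl

/-! Put `d = n - t`. The only input from regularity and depth is that `R` has projective dimension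
at most `d` over `Q` (`hasProjectiveDimensionLE_quotient_of_localDepth`): `Q` has global dimension
at most `n`, and dividing `R` by a regular sequence of length `t` raises the projective dimension by
`t`.

Ext: as `Ext^{d+1}(R, -) = 0`, the functor `Ext^d(R, -)` is right exact. It is additive, so on
finitely generated modules it is `Ext^d(R, Q) ⊗ -` (`lift_extPairing_bijective`).

Tor: in a resolution `P` of `R` by finitely generated projectives, `Z = P_d / im P_{d+1}` is
projective. `Tor_d(R, N)` is the kernel of `Z ⊗ N → P_{d-1} ⊗ N`, that is, of `Hom(Z*, N) →
Hom(P_{d-1}*, N)`. So it is `Hom(-, N)` of the cokernel of `P_{d-1}* → Z*`, which is `E`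
(`exists_torLinearEquiv`).

All modules involved are killed by `I`, so Hom and tensor product over `Q` and over `R` agree, and
tensor–Hom adjunction gives the rest. -/

/-! ### Regular local rings: quotients by a parameter, and integrality. -/

section RegularLocalRing

open IsLocalRing

/-- Exchange: an element of `𝔪 \ 𝔪²` is part of a minimal system of generators of `𝔪`. -/
theorem IsLocalRing.spanFinrank_map_maximalIdeal_lt {R : Type*} [CommRing R] [IsLocalRing R]
    [IsNoetherianRing R] {x : R} (hx : x ∈ maximalIdeal R) (hx2 : x ∉ maximalIdeal R ^ 2) :
    ((maximalIdeal R).map (Ideal.Quotient.mk (Ideal.span {x}))).spanFinrank + 1 ≤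
      (maximalIdeal R).spanFinrank := by
  classical
  obtain ⟨s, hcard, hs⟩ := Submodule.FG.exists_span_finset_card_eq_spanFinrank
    (maximalIdeal R).fg_of_isNoetherianRing
  have hxs : x ∈ Submodule.span R (s : Set R) := by rw [hs]; exact hx
  obtain ⟨a, -, ha⟩ := Submodule.mem_span_finset.1 hxs
  -- Some coefficient of `x` is a unit, since otherwise `x` would lie in `𝔪²`. Modulo `x`, the
  -- generator `y` is then redundant.
  obtain ⟨y, hy, hay⟩ : ∃ y ∈ s, a y ∉ maximalIdeal R := by
    by_contra! h
    apply hx2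
    rw [← ha, pow_two]
    refine Submodule.sum_mem _ fun y hy => Ideal.mul_mem_mul (h y hy) ?_
    rw [← hs]
    exact Submodule.subset_span hy
  have hu : IsUnit (a y) := by simpa using hay
  have hle : (maximalIdeal R).map (Ideal.Quotient.mk (Ideal.span {x})) ≤
      Submodule.span _ ((s.erase y).image (Ideal.Quotient.mk (Ideal.span {x})) : Set _) := by
    rw [← hs, ← Ideal.span, Ideal.map_span, Ideal.span_le]
    have key : ∀ z ∈ s, z ≠ y → Ideal.Quotient.mk (Ideal.span {x}) z ∈
        Ideal.span ((s.erase y).image (Ideal.Quotient.mk (Ideal.span {x})) : Set _) := by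
      intro z hz hzy
      apply Ideal.subset_span
      simp only [Finset.coe_image]
      exact ⟨z, by simp [hz, hzy], rfl⟩
    rintro _ ⟨z, hz, rfl⟩
    by_cases hzy : z = y
    · subst hzy
      have h1 : Ideal.Quotient.mk (Ideal.span {x}) (a z * z) =
          - ∑ w ∈ s.erase z, Ideal.Quotient.mk (Ideal.span {x}) (a w * w) := by
        rw [eq_neg_iff_add_eq_zero, ← map_sum, ← map_add]
        have : a z * z + ∑ w ∈ s.erase z, a w * w = x := by
          rw [← ha]; exact Finset.add_sum_erase s (fun w => a w * w) hz
        rw [this]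
        exact Ideal.Quotient.eq_zero_iff_mem.2 (Ideal.mem_span_singleton_self x)
      have h2 : Ideal.Quotient.mk (Ideal.span {x}) (a z * z) ∈
          Ideal.span ((s.erase z).image (Ideal.Quotient.mk (Ideal.span {x})) : Set _) := by
        rw [h1]
        refine neg_mem (Submodule.sum_mem _ fun w hw => ?_)
        rw [map_mul]
        exact Ideal.mul_mem_left _ _ (key w (Finset.mem_of_mem_erase hw) (Finset.ne_of_mem_erase hw))
      rw [map_mul] at h2
      exact (Ideal.unit_mul_mem_iff_mem _ (hu.map _)).1 h2
    · exact key z hz hzy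
  -- `spanFinrank` is not monotone in the ideal, so the inclusion `hle` alone gives no bound.
  have heq : (maximalIdeal R).map (Ideal.Quotient.mk (Ideal.span {x})) =
      Submodule.span _ ((s.erase y).image (Ideal.Quotient.mk (Ideal.span {x})) : Set _) := by
    apply le_antisymm hle
    rw [← Ideal.span, Ideal.span_le]
    intro z hz
    simp only [Finset.coe_image] at hz
    obtain ⟨w, hw, rfl⟩ := hz
    apply Ideal.mem_map_of_mem
    rw [← hs]
    exact Submodule.subset_span (Finset.mem_of_mem_erase hw)
  rw [heq, ← hcard]
  have h3 := Submodule.spanFinrank_span_le_ncard_of_finite (R := R ⧸ Ideal.span {x})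
    (Finset.finite_toSet ((s.erase y).image (Ideal.Quotient.mk (Ideal.span {x}))))
  rw [Set.ncard_coe_finset] at h3
  have h4 := Finset.card_image_le (s := s.erase y) (f := Ideal.Quotient.mk (Ideal.span {x}))
  have h5 := Finset.card_erase_add_one hy
  omega

/-- A squeeze: killing `x` lowers the dimension by at most one and the embedding dimension by at
least one, while dimension never exceeds embedding dimension. -/
theorem IsRegularLocalRing.quotient_span_singleton {R : Type*} [CommRing R] [IsRegularLocalRing R]
    {x : R} (hx : x ∈ maximalIdeal R) (hx2 : x ∉ maximalIdeal R ^ 2) {n : ℕ}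
    (hn : ringKrullDim R = (n + 1 : ℕ)) :
    IsRegularLocalRing (R ⧸ Ideal.span {x}) ∧ ringKrullDim (R ⧸ Ideal.span {x}) = n := by
  have hne : Ideal.span {x} ≠ ⊤ := by
    rw [Ne, Ideal.span_singleton_eq_top]; exact hx
  have : Nontrivial (R ⧸ Ideal.span {x}) := Ideal.Quotient.nontrivial_iff.2 hne
  have : IsLocalRing (R ⧸ Ideal.span {x}) :=
    IsLocalRing.of_surjective' _ Ideal.Quotient.mk_surjective
  have hmap := map_maximalIdeal_of_surjective _ (Ideal.Quotient.mk_surjective (I := Ideal.span {x}))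
  have h1 := IsLocalRing.spanFinrank_map_maximalIdeal_lt hx hx2
  have hreg := IsRegularLocalRing.spanFinrank_maximalIdeal (R := R)
  rw [hn] at hreg
  have hreg' : (maximalIdeal R).spanFinrank = n + 1 := by exact_mod_cast hreg
  rw [hmap, hreg'] at h1
  have h2 : ringKrullDim R ≤ ringKrullDim (R ⧸ Ideal.span {x}) + 1 := by
    have := ringKrullDim_le_ringKrullDim_quotient_add_card ({x} : Finset R)
      (by rw [IsLocalRing.ringJacobson_eq_maximalIdeal]; simpa using hx)
    rwa [Finset.coe_singleton, Finset.card_singleton, Nat.cast_one] at this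
  have h3 := ringKrullDim_le_spanFinrank_maximalIdeal (R ⧸ Ideal.span {x})
  have h4 : ((maximalIdeal (R ⧸ Ideal.span {x})).spanFinrank : WithBot ℕ∞) ≤ n := by
    exact_mod_cast (by omega : (maximalIdeal (R ⧸ Ideal.span {x})).spanFinrank ≤ n)
  have h5 : (n : WithBot ℕ∞) ≤ ringKrullDim (R ⧸ Ideal.span {x}) := by
    rw [hn] at h2
    refine (ENat.WithBot.add_le_add_natCast_right_iff (c := 1)).1 ?_
    simpa only [Nat.cast_add, Nat.cast_one] using h2
  exact ⟨.of_spanFinrank_maximalIdeal_le _ (h4.trans h5), le_antisymm (h3.trans h4) h5⟩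

/-- Prime avoidance gives `x ∈ 𝔪` outside `𝔪²` and outside all minimal primes. By induction `R/x` is
a domain, so the prime `(x)` contains a minimal prime `p`. Since `x ∉ p`, each element of `p` is `x`
times an element of `p`; hence `p = 𝔪p`, and `p = 0` by Nakayama. -/
theorem IsRegularLocalRing.isDomain_of_ringKrullDim_eq (n : ℕ) :
    ∀ (R : Type u) [CommRing R] [IsRegularLocalRing R], ringKrullDim R = n → IsDomain R := by
  induction n with
  | zero =>
    intro R _ _ hn
    have hreg := IsRegularLocalRing.spanFinrank_maximalIdeal (R := R)
    rw [hn] at hreg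
    have hreg' : (maximalIdeal R).spanFinrank = 0 := by exact_mod_cast hreg
    rw [Submodule.spanFinrank_eq_zero_iff_eq_bot (maximalIdeal R).fg_of_isNoetherianRing] at hreg'
    exact (IsLocalRing.isField_iff_maximalIdeal_eq.2 hreg').isDomain
  | succ n ih =>
    intro R _ _ hn
    have hfin := minimalPrimes.finite_of_isNoetherianRing R
    have hreg := IsRegularLocalRing.spanFinrank_maximalIdeal (R := R)
    have hbot : maximalIdeal R ≠ ⊥ := by
      intro h
      rw [hn, h, Submodule.spanFinrank_bot] at hreg
      have : (0 : ℕ) = n + 1 := by exact_mod_cast hreg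
      omega
    obtain ⟨x, hx, hx2, hxp⟩ : ∃ x ∈ maximalIdeal R, x ∉ maximalIdeal R ^ 2 ∧
        ∀ p ∈ minimalPrimes R, x ∉ p := by
      by_contra! h
      classical
      have hsub : (maximalIdeal R : Set R) ⊆
          ⋃ i ∈ ((insert (maximalIdeal R ^ 2) hfin.toFinset : Finset (Ideal R)) : Set (Ideal R)),
            ((id i : Ideal R) : Set R) := by
        intro x hx
        by_cases hx2 : x ∈ maximalIdeal R ^ 2
        · exact Set.mem_biUnion (x := maximalIdeal R ^ 2) (by simp) hx2
        · obtain ⟨p, hp, hxp⟩ := h x hx hx2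
          exact Set.mem_biUnion (x := p) (by simp [hp]) hxp
      -- Prime avoidance tolerates two ideals that need not be prime; `𝔪²` fills both places.
      obtain ⟨p, hp, hle⟩ := (Ideal.subset_union_prime (maximalIdeal R ^ 2) (maximalIdeal R ^ 2)
        (by
          intro i hi h1 _
          have : i ∈ minimalPrimes R := by simpa [h1] using hi
          exact this.1.1)).1 hsub
      rw [Finset.mem_insert, Set.Finite.mem_toFinset] at hp
      rcases hp with rfl | hp
      · apply hbot
        apply Submodule.eq_bot_of_le_smul_of_le_jacobson_bot (maximalIdeal R) _
          (maximalIdeal R).fg_of_isNoetherianRing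
        · rwa [smul_eq_mul, ← pow_two]
        · exact (jacobson_eq_maximalIdeal ⊥ bot_ne_top).ge
      · have : p = maximalIdeal R :=
          (le_maximalIdeal hp.1.1.ne_top).antisymm hle
        rw [this, ← Ideal.height_eq_zero_iff] at hp
        have h0 := maximalIdeal_height_eq_ringKrullDim (R := R)
        rw [hp, hn] at h0
        have : (0 : ℕ) = n + 1 := by exact_mod_cast h0
        omega
    obtain ⟨h1, h2⟩ := IsRegularLocalRing.quotient_span_singleton hx hx2 hn
    have := ih _ h2
    have : (Ideal.span {x}).IsPrime := (Ideal.Quotient.isDomain_iff_prime _).1 this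
    obtain ⟨p, hp, hpx⟩ := Ideal.exists_minimalPrimes_le (bot_le : ⊥ ≤ Ideal.span {x})
    have : p.IsPrime := hp.1.1
    have hp0 : p = ⊥ := by
      apply Submodule.eq_bot_of_le_smul_of_le_jacobson_bot (maximalIdeal R) _
        p.fg_of_isNoetherianRing
      · intro y hy
        obtain ⟨z, rfl⟩ := Ideal.mem_span_singleton'.1 (hpx hy)
        rw [mul_comm]
        exact Ideal.mul_mem_mul hx ((this.mem_or_mem hy).resolve_right (hxp p hp))
      · exact (jacobson_eq_maximalIdeal ⊥ bot_ne_top).ge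
    rw [hp0] at this
    exact (IsDomain.of_bot_isPrime R)

end RegularLocalRing

/-! ### Global dimension of regular local rings, and the bound `n - t`. -/

section GlobalDimension

open IsLocalRing Pointwise

/-- A trace of `Tor₁(M, R/x) = 0`: if `i k = x y`, then `x f(y) = 0`, so `f y = 0` and `y` comes
from `K`. It keeps a short exact sequence exact modulo `x`. -/
theorem IsSMulRegular.quotSMulTop_map_injective {R : Type*} [CommRing R] {K F M : Type*}
    [AddCommGroup K] [AddCommGroup F] [AddCommGroup M] [Module R K] [Module R F] [Module R M]
    {x : R} (hM : IsSMulRegular M x) {i : K →ₗ[R] F} {f : F →ₗ[R] M}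
    (hi : Function.Injective i) (hif : Function.Exact i f) :
    Function.Injective (QuotSMulTop.map x i) := by
  rw [← LinearMap.ker_eq_bot, eq_bot_iff]
  intro k hk
  obtain ⟨k, rfl⟩ := Submodule.mkQ_surjective _ k
  have h1 : (x • (⊤ : Submodule R F)).mkQ (i k) = 0 := hk
  rw [Submodule.mkQ_apply, Submodule.Quotient.mk_eq_zero,
    Submodule.mem_smul_pointwise_iff_exists] at h1
  obtain ⟨y, -, hy⟩ := h1
  have h2 : f y = 0 := by
    apply hM
    simp only [smul_zero]
    rw [← map_smul, hy, hif.apply_apply_eq_zero]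
  obtain ⟨z, rfl⟩ := (hif y).1 h2
  rw [← map_smul] at hy
  rw [Submodule.mem_bot, Submodule.mkQ_apply, Submodule.Quotient.mk_eq_zero, ← hi hy]
  exact Submodule.smul_mem_pointwise_smul _ _ _ trivial

/-- Killing a nonzerodivisor does not lower the projective dimension. -/
theorem hasProjectiveDimensionLE_of_quotSMulTop {R : Type u} [CommRing R] [IsLocalRing R]
    [IsNoetherianRing R] {x : R} (hx : x ∈ maximalIdeal R) (hR : IsSMulRegular R x) (k : ℕ) :
    ∀ (M : Type u) [AddCommGroup M] [Module R M] [Module.Finite R M], IsSMulRegular M x →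
      HasProjectiveDimensionLE (ModuleCat.of (R ⧸ Ideal.span {x}) (QuotSMulTop x M)) k →
      HasProjectiveDimensionLE (ModuleCat.of R M) k := by
  have hne : Ideal.span {x} ≠ ⊤ := by
    rw [Ne, Ideal.span_singleton_eq_top]; exact hx
  have : Nontrivial (R ⧸ Ideal.span {x}) := Ideal.Quotient.nontrivial_iff.2 hne
  have : IsLocalRing (R ⧸ Ideal.span {x}) :=
    IsLocalRing.of_surjective' _ Ideal.Quotient.mk_surjective
  have fin (M : Type u) [AddCommGroup M] [Module R M] [Module.Finite R M] :
      Module.Finite (R ⧸ Ideal.span {x}) (QuotSMulTop x M) :=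
    Module.Finite.of_restrictScalars_finite R _ _
  induction k with
  | zero =>
    intro M _ _ _ hM h
    rw [← projective_iff_hasProjectiveDimensionLE_zero, ← IsProjective.iff_projective] at h ⊢
    have := fin M
    have hfree : Module.Free (R ⧸ Ideal.span {x}) (QuotSMulTop x M) :=
      Module.free_of_flat_of_isLocalRing
    -- Freeness lifts from `M/xM` to `M` because `x` is `M`-regular and lies in the Jacobson
    -- radical.
    have : Module.FinitePresentation R M := Module.finitePresentation_of_finite R M
    have : Module.Free R M := (Module.free_quotSMulTop_iff_free R M
      ((jacobson_eq_maximalIdeal ⊥ bot_ne_top).ge hx) hM).1 hfree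
    infer_instance
  | succ k ih =>
    intro M _ _ _ hM h
    -- Dimension shifting over `R` and over `R/x` at once: the syzygy of `M` reduces modulo `x` to a
    -- syzygy of `M/xM`.
    obtain ⟨m, f, hf⟩ := Module.Finite.exists_fin' R M
    have hreg : IsSMulRegular (Fin m → R) x := IsSMulRegular.pi fun _ => hR
    have hK : IsSMulRegular (LinearMap.ker f) x :=
      hreg.of_injective (LinearMap.ker f).subtype Subtype.val_injective
    let S := f.shortComplexKer
    have hS : S.ShortExact := LinearMap.shortExact_shortComplexKer hf
    have hex : Function.Exact (LinearMap.ker f).subtype f := LinearMap.exact_subtype_ker_map f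
    let g₁ := LinearMap.extendScalarsOfSurjective
      (Ideal.Quotient.mk_surjective (I := Ideal.span {x})) (QuotSMulTop.map x (LinearMap.ker f).subtype)
    let g₂ := LinearMap.extendScalarsOfSurjective
      (Ideal.Quotient.mk_surjective (I := Ideal.span {x})) (QuotSMulTop.map x f)
    have hgex : Function.Exact g₁ g₂ := QuotSMulTop.map_exact x hex hf
    let S' : ShortComplex (ModuleCat (R ⧸ Ideal.span {x})) :=
      ModuleCat.shortComplexOfCompEqZero g₁ g₂ hgex.linearMap_comp_eq_zero
    have hS' : S'.ShortExact :=
      { exact := ModuleCat.shortComplex_exact _ hgex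
        mono_f := (ModuleCat.mono_iff_injective _).2
          (hM.quotSMulTop_map_injective Subtype.val_injective hex)
        epi_g := (ModuleCat.epi_iff_surjective _).2 (QuotSMulTop.map_surjective x hf) }
    have hp' : Projective S'.X₂ :=
      (IsProjective.iff_projective (QuotSMulTop x (Fin m → R))).1 inferInstance
    have hp : Projective S.X₂ := (IsProjective.iff_projective (Fin m → R)).1 inferInstance
    have h1 := (hS'.hasProjectiveDimensionLT_X₃_iff k hp').1 h
    exact (hS.hasProjectiveDimensionLT_X₃_iff k hp).2 (ih _ hK h1)

/-- `M` may have `x`-torsion, so the induction is applied to its first syzygy `K`. As a submodule of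
a free module over a domain, `K` has `x` as a regular element, and `K/xK` lives over the regular
ring `R/x` of dimension one less. -/
theorem IsRegularLocalRing.hasProjectiveDimensionLE (n : ℕ) :
    ∀ (R : Type u) [CommRing R] [IsRegularLocalRing R], ringKrullDim R = n →
      ∀ (M : Type u) [AddCommGroup M] [Module R M] [Module.Finite R M],
        HasProjectiveDimensionLE (ModuleCat.of R M) n := by
  induction n with
  | zero =>
    intro R _ _ hn M _ _ _
    have hreg := IsRegularLocalRing.spanFinrank_maximalIdeal (R := R)
    rw [hn] at hreg
    have hreg' : (maximalIdeal R).spanFinrank = 0 := by exact_mod_cast hreg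
    rw [Submodule.spanFinrank_eq_zero_iff_eq_bot (maximalIdeal R).fg_of_isNoetherianRing] at hreg'
    let := (IsLocalRing.isField_iff_maximalIdeal_eq.2 hreg').toField
    rw [← projective_iff_hasProjectiveDimensionLE_zero, ← IsProjective.iff_projective]
    infer_instance
  | succ n ih =>
    intro R _ _ hn M _ _ _
    have := IsRegularLocalRing.isDomain_of_ringKrullDim_eq _ R hn
    obtain ⟨x, hx, hx2⟩ : ∃ x ∈ maximalIdeal R, x ∉ maximalIdeal R ^ 2 := by
      by_contra! h
      have hbot : maximalIdeal R = ⊥ := by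
        apply Submodule.eq_bot_of_le_smul_of_le_jacobson_bot (maximalIdeal R) _
          (maximalIdeal R).fg_of_isNoetherianRing
        · rw [smul_eq_mul, ← pow_two]; exact h
        · exact (jacobson_eq_maximalIdeal ⊥ bot_ne_top).ge
      have hreg := IsRegularLocalRing.spanFinrank_maximalIdeal (R := R)
      rw [hn, hbot, Submodule.spanFinrank_bot] at hreg
      have : (0 : ℕ) = n + 1 := by exact_mod_cast hreg
      omega
    have hx0 : x ≠ 0 := by rintro rfl; exact hx2 (zero_mem _)
    have hR : IsSMulRegular R x := .of_ne_zero hx0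
    obtain ⟨h1, h2⟩ := IsRegularLocalRing.quotient_span_singleton hx hx2 hn
    obtain ⟨m, f, hf⟩ := Module.Finite.exists_fin' R M
    have hreg : IsSMulRegular (Fin m → R) x := IsSMulRegular.pi fun _ => hR
    have hK : IsSMulRegular (LinearMap.ker f) x :=
      hreg.of_injective (LinearMap.ker f).subtype Subtype.val_injective
    have : Module.Finite (R ⧸ Ideal.span {x}) (QuotSMulTop x (LinearMap.ker f)) :=
      Module.Finite.of_restrictScalars_finite R _ _
    have hp : Projective f.shortComplexKer.X₂ :=
      (IsProjective.iff_projective (Fin m → R)).1 inferInstance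
    exact ((LinearMap.shortExact_shortComplexKer hf).hasProjectiveDimensionLT_X₃_iff n hp).2
      (hasProjectiveDimensionLE_of_quotSMulTop hx hR n _ hK (ih _ h2 _))

/-- Over a regular local ring `Q` of dimension `n`, a quotient ring of depth `t` has projective
dimension at most `n - t`. -/
theorem hasProjectiveDimensionLE_quotient_of_localDepth {Q : Type u} [CommRing Q]
    [IsRegularLocalRing Q] (I : Ideal Q) [IsLocalRing (Q ⧸ I)] (n t : ℕ)
    (hn : ringKrullDim Q = n) (ht : localDepth (Q ⧸ I) = t) :
    HasProjectiveDimensionLE (ModuleCat.of Q (Q ⧸ I)) (n - t) := by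
  obtain ⟨rs, hmem, hreg, hlen⟩ : ∃ rs : List (Q ⧸ I), (∀ r ∈ rs, r ∈ maximalIdeal (Q ⧸ I)) ∧
      RingTheory.Sequence.IsRegular (Q ⧸ I) rs ∧ rs.length = t := by
    have : Nonempty {rs : List (Q ⧸ I) // (∀ r ∈ rs, r ∈ IsLocalRing.maximalIdeal (Q ⧸ I)) ∧
        RingTheory.Sequence.IsRegular (Q ⧸ I) rs} := ⟨[], by simp, .nil _ _⟩
    -- The supremum defining the depth is finite, hence attained.
    obtain ⟨rs, h⟩ := ENat.exists_eq_iSup_of_lt_top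
      (lt_of_eq_of_lt ht (ENat.natCast_lt_top t))
    refine ⟨rs.1, rs.2.1, rs.2.2, ?_⟩
    have h' := h.trans ht
    exact_mod_cast h'
  obtain ⟨qs, rfl⟩ : ∃ qs : List Q, qs.map (algebraMap Q (Q ⧸ I)) = rs :=
    List.map_surjective_iff.2 Ideal.Quotient.mk_surjective rs
  have hq : RingTheory.Sequence.IsWeaklyRegular (Q ⧸ I) qs :=
    (RingTheory.Sequence.isWeaklyRegular_map_algebraMap_iff (Q ⧸ I) (Q ⧸ I) qs).1 hreg.1
  have hqm : ∀ r ∈ qs, r ∈ maximalIdeal Q := by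
    intro r hr hu
    exact hmem _ (List.mem_map_of_mem hr) (hu.map _)
  rw [List.length_map] at hlen
  have h1 := ModuleCat.projectiveDimension_quotient_eq_add_length_of_isWeaklyRegular
    (ModuleCat.of Q (Q ⧸ I)) qs hq hqm
  have h2 := IsRegularLocalRing.hasProjectiveDimensionLE n Q hn
    ((Q ⧸ I) ⧸ Ideal.ofList qs • (⊤ : Submodule Q (Q ⧸ I)))
  rw [← projectiveDimension_le_iff] at h2 ⊢
  erw [h1] at h2
  rw [hlen] at h2
  have h0 : projectiveDimension (ModuleCat.of Q (Q ⧸ I)) ≠ ⊥ := by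
    rw [Ne, projectiveDimension_eq_bot_iff, ModuleCat.isZero_iff_subsingleton]
    exact not_subsingleton (Q ⧸ I)
  generalize projectiveDimension (ModuleCat.of Q (Q ⧸ I)) = p at h0 h2
  obtain ⟨p, rfl⟩ := WithBot.ne_bot_iff_exists.1 h0
  cases p with
  | top =>
    have h3 : (⊤ : ℕ∞) + t ≤ n := WithBot.coe_le_coe.1 h2
    simp at h3
  | coe p =>
    -- This also gives `t ≤ n`, so the subtraction `n - t` is not truncated.
    have : p + t ≤ n := by exact_mod_cast h2
    exact WithBot.coe_le_coe.2 (Nat.cast_le.2 (by omega))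

end GlobalDimension

/-! ### Top Ext as a tensor product. -/

section ExtTensor

open Abelian TensorProduct

variable {Q : Type u} [CommRing Q] (X : ModuleCat.{u} Q) (d : ℕ)

/-- The pairing `Ext^d(X, Q) × N → Ext^d(X, N)` that composes a class with the map `Q → N`
determined by an element of `N`. -/
noncomputable def extPairing (N : ModuleCat.{u} Q) :
    Ext X (ModuleCat.of Q Q) d →ₗ[Q] N →ₗ[Q] Ext X N d :=
  LinearMap.mk₂ Q
    (fun e m => e.comp (Ext.mk₀ (ModuleCat.ofHom (LinearMap.toSpanSingleton Q N m))) (add_zero d))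
    (fun _ _ _ => Ext.add_comp _ _ _ _)
    (fun _ _ _ => Ext.smul_comp _ _ _ _)
    (fun e m m' => by
      rw [LinearMap.toSpanSingleton_add, ModuleCat.ofHom_add, Ext.mk₀_add, Ext.comp_add])
    (fun r e m => by
      have : ModuleCat.ofHom (r • LinearMap.toSpanSingleton Q N m) =
          r • ModuleCat.ofHom (LinearMap.toSpanSingleton Q N m) := rfl
      rw [LinearMap.toSpanSingleton_smul, this, Ext.mk₀_smul, Ext.comp_smul])

theorem extPairing_comp_mk₀ {N N' : ModuleCat.{u} Q} (g : N ⟶ N')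
    (e : Ext X (ModuleCat.of Q Q) d) (m : N) :
    (extPairing X d N e m).comp (Ext.mk₀ g) (add_zero d) = extPairing X d N' e (g.hom m) := by
  have : ModuleCat.ofHom (LinearMap.toSpanSingleton Q N m) ≫ g =
      ModuleCat.ofHom (LinearMap.toSpanSingleton Q N' (g.hom m)) := by
    ext
    simp
  simp only [extPairing, LinearMap.mk₂_apply]
  rw [Ext.comp_assoc_of_third_deg_zero, Ext.mk₀_comp_mk₀, this]

theorem lift_extPairing_comp_mk₀ {N N' : ModuleCat.{u} Q} (g : N ⟶ N')
    (y : Ext X (ModuleCat.of Q Q) d ⊗[Q] N) :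
    (lift (extPairing X d N) y).comp (Ext.mk₀ g) (add_zero d) =
      lift (extPairing X d N') (g.hom.lTensor _ y) := by
  induction y using TensorProduct.induction_on with
  | zero => simp
  | tmul e m => simpa using extPairing_comp_mk₀ X d g e m
  | add y z h1 h2 => rw [map_add, Ext.add_comp, h1, h2, map_add, map_add]

/-- Additivity of Ext: writing the identity of `Q^k` as the sum of its coordinate projections
followed by inclusions yields the inverse. No bound on projective dimension enters. -/
theorem lift_extPairing_bijective_of_pi (k : ℕ) :
    Function.Bijective (lift (extPairing X d (ModuleCat.of Q (Fin k → Q)))) := by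
  let p (i : Fin k) : ModuleCat.of Q (Fin k → Q) ⟶ ModuleCat.of Q Q :=
    ModuleCat.ofHom (LinearMap.proj i)
  let s (i : Fin k) : ModuleCat.of Q (Fin k → Q) := Pi.single i (1 : Q)
  have hs : ∑ i, p i ≫ ModuleCat.ofHom (LinearMap.toSpanSingleton Q _ (s i)) = 𝟙 _ := by
    refine ModuleCat.hom_ext (LinearMap.ext fun v => ?_)
    rw [ModuleCat.hom_sum, LinearMap.sum_apply]
    exact (pi_eq_sum_univ' v).symm
  refine Function.bijective_iff_has_inverse.2
    ⟨fun x => ∑ i, (x.comp (Ext.mk₀ (p i)) (add_zero d)) ⊗ₜ s i, fun y => ?_, fun x => ?_⟩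
  · induction y using TensorProduct.induction_on with
    | zero => simp
    | tmul e v =>
      have h (i : Fin k) : (extPairing X d _ e v).comp (Ext.mk₀ (p i)) (add_zero d) =
          (v : Fin k → Q) i • e := by
        rw [extPairing_comp_mk₀]
        have : ModuleCat.ofHom (LinearMap.toSpanSingleton Q Q ((v : Fin k → Q) i)) =
            ((v : Fin k → Q) i) • 𝟙 (ModuleCat.of Q Q) := by
          ext
          simp
        change e.comp (Ext.mk₀ (ModuleCat.ofHom
          (LinearMap.toSpanSingleton Q Q ((v : Fin k → Q) i)))) (add_zero d) = _
        rw [this, Ext.mk₀_smul, Ext.comp_smul, Ext.comp_mk₀_id]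
      simp only [lift.tmul, h, smul_tmul, ← tmul_sum]
      congr 1
      exact (pi_eq_sum_univ' v).symm
    | add y z h1 h2 =>
      simp only [map_add, Ext.add_comp, add_tmul, Finset.sum_add_distrib, h1, h2]
  · simp only [map_sum, lift.tmul]
    have h (i : Fin k) : extPairing X d _ (x.comp (Ext.mk₀ (p i)) (add_zero d)) (s i) =
        x.comp (Ext.mk₀ (p i ≫ ModuleCat.ofHom (LinearMap.toSpanSingleton Q _ (s i))))
          (add_zero d) := by
      rw [← Ext.mk₀_comp_mk₀, ← Ext.comp_assoc_of_third_deg_zero]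
      rfl
    simp only [h]
    conv_rhs => rw [← Ext.comp_mk₀_id x, ← hs]
    rw [Ext.mk₀_sum, Ext.comp_sum]

variable [HasProjectiveDimensionLE X d]

/-- `Ext^{d+1}(X, ker f) = 0`, so every class in `Ext^d(X, N)` lifts along a cover `f : Q^k → N`. -/
theorem lift_extPairing_surjective (N : ModuleCat.{u} Q) [Module.Finite Q N] :
    Function.Surjective (lift (extPairing X d N)) := by
  intro x
  obtain ⟨k, f, hf⟩ := Module.Finite.exists_fin' Q N
  obtain ⟨x₂, hx₂⟩ := Ext.covariant_sequence_exact₃ X (LinearMap.shortExact_shortComplexKer hf) x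
    rfl (Ext.eq_zero_of_hasProjectiveDimensionLT _ (d + 1) le_rfl)
  obtain ⟨y, rfl⟩ := (lift_extPairing_bijective_of_pi X d k).2 x₂
  exact ⟨f.lTensor _ y, (lift_extPairing_comp_mk₀ X d (ModuleCat.ofHom f) y).symm.trans hx₂⟩

/-- If `X` has projective dimension at most `d`, then `Ext^d(X, Q) ⊗ N → Ext^d(X, N)` is bijective
for every finitely generated `N`. -/
theorem lift_extPairing_bijective [IsNoetherianRing Q] (N : ModuleCat.{u} Q) [Module.Finite Q N] :
    Function.Bijective (lift (extPairing X d N)) := by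
  refine ⟨?_, lift_extPairing_surjective X d N⟩
  rw [← LinearMap.ker_eq_bot, eq_bot_iff]
  intro y hy
  obtain ⟨k, f, hf⟩ := Module.Finite.exists_fin' Q N
  obtain ⟨y, rfl⟩ := f.lTensor_surjective _ hf y
  obtain ⟨x₁, hx₁⟩ := Ext.covariant_sequence_exact₂ X (LinearMap.shortExact_shortComplexKer hf)
    (lift (extPairing X d (ModuleCat.of Q (Fin k → Q))) y)
    ((lift_extPairing_comp_mk₀ X d (ModuleCat.ofHom f) y).trans hy)
  -- Four lemma: surjectivity for the kernel, finitely generated since `Q` is noetherian, gives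
  -- injectivity for `N`.
  obtain ⟨z, rfl⟩ := lift_extPairing_surjective X d (ModuleCat.of Q (LinearMap.ker f)) x₁
  have h1 : (LinearMap.ker f).subtype.lTensor _ z = y :=
    (lift_extPairing_bijective_of_pi X d k).1 ((lift_extPairing_comp_mk₀ X d
      (ModuleCat.ofHom (LinearMap.ker f).subtype) z).symm.trans hx₁)
  rw [← h1, ← LinearMap.comp_apply, ← LinearMap.lTensor_comp]
  have h2 : f ∘ₗ (LinearMap.ker f).subtype = 0 := by ext; simp
  rw [h2]
  simp

end ExtTensor

/-! ### Contraction, and Hom out of the cokernel of a dual map. -/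

section DualTensor

open TensorProduct

variable {Q : Type*} [CommRing Q] {Z P E T : Type*} (M : Type*) [AddCommGroup Z] [AddCommGroup P]
  [AddCommGroup E] [AddCommGroup T] [AddCommGroup M] [Module Q Z] [Module Q P] [Module Q E]
  [Module Q T] [Module Q M]

/-- The contraction `Z ⊗ M → Hom(Z*, M)`. -/
noncomputable def tensorContraction : Z ⊗[Q] M →ₗ[Q] (Z →ₗ[Q] Q) →ₗ[Q] M :=
  lift (LinearMap.mk₂ Q (fun z m => (LinearMap.applyₗ z).smulRight m)
    (fun z z' m => by ext h; simp [add_smul])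
    (fun r z m => by ext h; simp [mul_smul])
    (fun z m m' => by ext h; simp)
    (fun r z m => by ext h; exact smul_comm _ _ _))

@[simp]
theorem tensorContraction_tmul (z : Z) (m : M) (h : Z →ₗ[Q] Q) :
    tensorContraction M (z ⊗ₜ m) h = h z • m := by
  simp [tensorContraction]

theorem tensorContraction_rTensor (δ : Z →ₗ[Q] P) (w : Z ⊗[Q] M) (g : P →ₗ[Q] Q) :
    tensorContraction M (δ.rTensor M w) g = tensorContraction M w (g ∘ₗ δ) := by
  induction w using TensorProduct.induction_on with
  | zero => simp
  | tmul z m => simp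
  | add x y h1 h2 => simp only [map_add, LinearMap.add_apply, h1, h2]

variable {M} in
theorem tensorContraction_lTensor {M' : Type*} [AddCommGroup M'] [Module Q M'] (f : M →ₗ[Q] M')
    (w : Z ⊗[Q] M) (h : Z →ₗ[Q] Q) :
    tensorContraction M' (f.lTensor Z w) h = f (tensorContraction M w h) := by
  induction w using TensorProduct.induction_on with
  | zero => simp
  | tmul z m => simp
  | add x y h1 h2 => simp only [map_add, LinearMap.add_apply, h1, h2]

/-- A splitting of `Q^k → Z` provides a dual basis `b`, `e`, and `ψ ↦ ∑ b i ⊗ ψ (e i)` is the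
inverse. -/
theorem tensorContraction_bijective [Module.Finite Q Z] [Module.Projective Q Z] :
    Function.Bijective (tensorContraction (Q := Q) (Z := Z) M) := by
  obtain ⟨k, f, hf⟩ := Module.Finite.exists_fin' Q Z
  obtain ⟨s, hs⟩ := Module.projective_lifting_property f LinearMap.id hf
  let b (i : Fin k) : Z := f (Pi.single i 1)
  let e (i : Fin k) : Z →ₗ[Q] Q := LinearMap.proj i ∘ₗ s
  have hbe (z : Z) : ∑ i, e i z • b i = z := by
    have h1 : f (s z) = z := LinearMap.congr_fun hs z
    conv_rhs => rw [← h1, pi_eq_sum_univ' (s z), map_sum]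
    simp only [map_smul]
    rfl
  refine Function.bijective_iff_has_inverse.2
    ⟨fun ψ => ∑ i, b i ⊗ₜ ψ (e i), fun w => ?_, fun ψ => ?_⟩
  · induction w using TensorProduct.induction_on with
    | zero => simp
    | tmul z m => simp only [tensorContraction_tmul, ← smul_tmul, ← sum_tmul, hbe]
    | add x y h1 h2 =>
      simp only [map_add, LinearMap.add_apply, tmul_add, Finset.sum_add_distrib, h1, h2]
  · ext h
    simp only [map_sum, LinearMap.sum_apply, tensorContraction_tmul, ← map_smul]
    rw [← map_sum]
    congr 1
    ext z
    conv_rhs => rw [← hbe z]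
    simp [mul_comm]

variable {M} in
/-- Let `E` be the cokernel of the dual of a map `δ : Z → P` of finitely generated projective
modules. Then the kernel of `δ ⊗ M` is `Hom(E, M)`. -/
theorem exists_linearEquiv_of_ker_rTensor [Module.Finite Q Z] [Module.Projective Q Z]
    [Module.Finite Q P] [Module.Projective Q P] (δ : Z →ₗ[Q] P) (c : (Z →ₗ[Q] Q) →ₗ[Q] E)
    (hc : Function.Surjective c) (hker : ∀ h, c h = 0 ↔ ∃ g : P →ₗ[Q] Q, g ∘ₗ δ = h)
    (ι : T →ₗ[Q] Z ⊗[Q] M) (hι : Function.Injective ι)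
    (hrange : Function.Exact ι (δ.rTensor M)) :
    ∃ Φ : T ≃ₗ[Q] (E →ₗ[Q] M), ∀ τ h, Φ τ (c h) = tensorContraction M (ι τ) h := by
  -- Both `T` and `Hom(E, M)` embed in `Hom(Z*, M)`. Each image consists of the maps that vanish on
  -- all `g ∘ δ`.
  let A : T →ₗ[Q] (Z →ₗ[Q] Q) →ₗ[Q] M := tensorContraction M ∘ₗ ι
  let B : (E →ₗ[Q] M) →ₗ[Q] (Z →ₗ[Q] Q) →ₗ[Q] M := LinearMap.lcomp Q M c
  have hA : Function.Injective A := (tensorContraction_bijective M).1.comp hι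
  have hB : Function.Injective B := fun f g h => by
    ext x
    obtain ⟨y, rfl⟩ := hc x
    exact LinearMap.congr_fun h y
  have hAB : LinearMap.range A = LinearMap.range B := by
    apply le_antisymm
    · rintro _ ⟨τ, rfl⟩
      have hle : LinearMap.ker c ≤ LinearMap.ker (A τ) := by
        intro h hh
        obtain ⟨g, rfl⟩ := (hker h).1 hh
        change tensorContraction M (ι τ) (g ∘ₗ δ) = 0
        rw [← tensorContraction_rTensor, hrange.apply_apply_eq_zero]
        simp
      refine ⟨(LinearMap.ker c).liftQ (A τ) hle ∘ₗ (c.quotKerEquivOfSurjective hc).symm, ?_⟩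
      ext h
      have : (c.quotKerEquivOfSurjective hc).symm (c h) = Submodule.Quotient.mk h := by
        rw [LinearEquiv.symm_apply_eq]
        rfl
      change (LinearMap.ker c).liftQ (A τ) hle ((c.quotKerEquivOfSurjective hc).symm (c h)) = _
      rw [this, Submodule.liftQ_apply]
    · rintro _ ⟨ψ, rfl⟩
      obtain ⟨w, hw⟩ := (tensorContraction_bijective M).2 (B ψ)
      -- Here the contraction for `P`, not `Z`, must be injective.
      obtain ⟨τ, rfl⟩ := (hrange w).1 (by
        apply (tensorContraction_bijective M).1
        ext g
        rw [tensorContraction_rTensor, hw, map_zero]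
        change ψ (c (g ∘ₗ δ)) = 0
        rw [(hker _).2 ⟨g, rfl⟩, map_zero])
      exact ⟨τ, hw⟩
  refine ⟨LinearEquiv.ofInjective A hA ≪≫ₗ LinearEquiv.ofEq _ _ hAB ≪≫ₗ
    (LinearEquiv.ofInjective B hB).symm, fun τ h => ?_⟩
  have h1 : B ((LinearEquiv.ofInjective A hA ≪≫ₗ LinearEquiv.ofEq _ _ hAB ≪≫ₗ
      (LinearEquiv.ofInjective B hB).symm) τ) = A τ := by
    exact congrArg Subtype.val (LinearEquiv.apply_symm_apply (LinearEquiv.ofInjective B hB) _)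
  exact LinearMap.congr_fun h1 h

end DualTensor

/-! ### Top Tor as Hom out of top Ext. -/

section TorHom

open Abelian MonoidalCategory

/-- Stated with `next n` to include degree `0`: there `next 0 = 0` and the differential is zero, so
the condition reads `f = 0`. Later arguments need no case split on `d`. -/
theorem CategoryTheory.ProjectiveResolution.extMk_eq_zero_iff_next {C : Type*} [Category* C]
    [Abelian C] [HasExt C] {X Y : C} (P : ProjectiveResolution X) {n : ℕ} (f : P.complex.X n ⟶ Y)
    (m : ℕ) (hm : n + 1 = m) (hf : P.complex.d m n ≫ f = 0) :
    P.extMk f m hm hf = 0 ↔ ∃ g : P.complex.X ((ComplexShape.down ℕ).next n) ⟶ Y,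
      P.complex.d n ((ComplexShape.down ℕ).next n) ≫ g = f := by
  cases n with
  | zero =>
    have h0 : P.complex.d 0 ((ComplexShape.down ℕ).next 0) = 0 :=
      P.complex.shape _ _ (by simp)
    simp only [← P.extEquivCohomologyClass.apply_eq_iff_eq, extEquivCohomologyClass_extMk,
      extEquivCohomologyClass_zero, CochainComplex.HomComplex.CohomologyClass.mk_eq_zero_iff]
    rw [CochainComplex.HomComplex.Cocycle.toSingleMk_mem_coboundaries_iff _ _ _ _ _ 1 (by simp)]
    have h1 : P.cochainComplex.d 0 1 = 0 := by
      apply Limits.IsZero.eq_of_tgt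
      exact P.cochainComplex.isZero_of_isStrictlyLE 0 1 (by simp)
    simp [h1, eq_comm (a := (0 : _ ⟶ Y))]
  | succ p =>
    have : (ComplexShape.down ℕ).next (p + 1) = p := by simp
    rw [this]
    exact P.extMk_eq_zero_iff f m hm hf p rfl

/-- The differential, corestricted to `k : P_{d+1} → ker π`, is a cocycle whose class lies in
`Ext^{d+1}(X, ker π) = 0`. So `k` extends to `g : P_d → ker π`, which retracts the inclusion because
`k` is epi. Hence `π` splits. -/
theorem CategoryTheory.ProjectiveResolution.projective_opcycles {C : Type*} [Category* C]
    [Abelian C] [HasExt C] {X : C} (P : ProjectiveResolution X) (d : ℕ)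
    [HasProjectiveDimensionLE X d] : Projective (P.complex.opcycles d) := by
  let π := P.complex.pOpcycles d
  let k : P.complex.X (d + 1) ⟶ Limits.kernel π :=
    Limits.kernel.lift π (P.complex.d (d + 1) d) (P.complex.d_pOpcycles _ _)
  have hk : k ≫ Limits.kernel.ι π = P.complex.d (d + 1) d := Limits.kernel.lift_ι _ _ _
  have hepi : Epi k := by
    have : (ShortComplex.mk _ _ (P.complex.d_pOpcycles (d + 1) d)).Exact :=
      ShortComplex.exact_of_g_is_cokernel _
        (P.complex.opcyclesIsCokernel (d + 1) d (by simp))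
    exact this.epi_kernelLift
  have h0 : P.extMk k (d + 2) rfl
      (by rw [← cancel_mono (Limits.kernel.ι π), Category.assoc, hk]; simp) = 0 :=
    Ext.eq_zero_of_hasProjectiveDimensionLT _ (d + 1) le_rfl
  obtain ⟨g, hg⟩ := (P.extMk_eq_zero_iff k (d + 2) rfl _ d rfl).1 h0
  have hg' : Limits.kernel.ι π ≫ g = 𝟙 _ := by
    rw [← cancel_epi k, ← Category.assoc, hk, hg, Category.comp_id]
  let s : P.complex.opcycles d ⟶ P.complex.X d :=
    P.complex.descOpcycles (𝟙 _ - g ≫ Limits.kernel.ι π) (d + 1) (by simp) (by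
      rw [Preadditive.comp_sub, Category.comp_id, reassoc_of% hg, hk, sub_self])
  have hs : s ≫ π = 𝟙 _ := by
    rw [← cancel_epi π]
    dsimp only [π, s]
    rw [HomologicalComplex.p_descOpcycles_assoc]
    simp
  exact (Retract.mk s π hs).projective

variable {Q : Type u} [CommRing Q] {X : ModuleCat.{u} Q} (P : ProjectiveResolution X) (d : ℕ)

/-- Composition with a class in `Ext^d(X, Z)`. -/
noncomputable def extCompLinear {d : ℕ} {Z : ModuleCat.{u} Q} (ξ : Ext X Z d) (Y : ModuleCat.{u} Q) :
    (Z →ₗ[Q] Y) →ₗ[Q] Ext X Y d where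
  toFun h := ξ.comp (Ext.mk₀ (ModuleCat.ofHom h)) (add_zero d)
  map_add' h h' := by rw [ModuleCat.ofHom_add, Ext.mk₀_add, Ext.comp_add]
  map_smul' r h := by
    have : ModuleCat.ofHom (r • h) = r • ModuleCat.ofHom h := rfl
    rw [this, Ext.mk₀_smul, Ext.comp_smul, RingHom.id_apply]

/-- The `d`-cocycle `P_d → P_d / im P_{d+1}` composed with linear forms, as a map from the dual of
`P_d / im P_{d+1}` onto `Ext^d(X, Q)`. -/
noncomputable def opcyclesDualToExt :
    (P.complex.opcycles d →ₗ[Q] Q) →ₗ[Q] Ext X (ModuleCat.of Q Q) d :=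
  extCompLinear (P.extMk (P.complex.pOpcycles d) (d + 1) rfl (by simp)) (ModuleCat.of Q Q)

theorem opcyclesDualToExt_apply (h : P.complex.opcycles d ⟶ ModuleCat.of Q Q) :
    opcyclesDualToExt P d h.hom =
      P.extMk (P.complex.pOpcycles d ≫ h) (d + 1) rfl (by simp) :=
  P.extMk_comp_mk₀ _ _ _ _ h

theorem opcyclesDualToExt_surjective : Function.Surjective (opcyclesDualToExt P d) := by
  intro α
  obtain ⟨f, hf, rfl⟩ := P.extMk_surjective α (d + 1) rfl
  refine ⟨(P.complex.descOpcycles f (d + 1) (by simp) hf).hom, ?_⟩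
  rw [opcyclesDualToExt_apply]
  congr 1
  simp

/-- Together with surjectivity, this exhibits `Ext^d(X, Q)` as the cokernel of the dual of `P_d / im
P_{d+1} → P_{d-1}`, as `exists_linearEquiv_of_ker_rTensor` requires. -/
theorem opcyclesDualToExt_eq_zero_iff (h : P.complex.opcycles d →ₗ[Q] Q) :
    opcyclesDualToExt P d h = 0 ↔ ∃ g : P.complex.X ((ComplexShape.down ℕ).next d) →ₗ[Q] Q,
      g ∘ₗ (P.complex.fromOpcycles d ((ComplexShape.down ℕ).next d)).hom = h := by
  obtain ⟨h, rfl⟩ :=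
    ModuleCat.hom_surjective (M := P.complex.opcycles d) (N := ModuleCat.of Q Q) h
  rw [opcyclesDualToExt_apply, P.extMk_eq_zero_iff_next]
  constructor
  · rintro ⟨g, hg⟩
    refine ⟨g.hom, ?_⟩
    have : P.complex.fromOpcycles d _ ≫ g = h := by
      rw [← cancel_epi (P.complex.pOpcycles d), HomologicalComplex.p_fromOpcycles_assoc, hg]
    exact congrArg ModuleCat.Hom.hom this
  · rintro ⟨g, hg⟩
    have : h = P.complex.fromOpcycles d _ ≫ ModuleCat.ofHom g := ModuleCat.hom_ext hg.symm
    exact ⟨ModuleCat.ofHom g, by rw [this, HomologicalComplex.p_fromOpcycles_assoc]⟩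

/-- The complex `P ⊗ N`. -/
noncomputable abbrev tensorResolution (N : ModuleCat.{u} Q) : ChainComplex (ModuleCat.{u} Q) ℕ :=
  (((tensoringRight (ModuleCat.{u} Q)).obj N).mapHomologicalComplex (ComplexShape.down ℕ)).obj
    P.complex

/-- The map from `(P_d ⊗ N) / im (P_{d+1} ⊗ N)` to `(P_d / im P_{d+1}) ⊗ N`. -/
noncomputable def opcyclesTensorResolution (N : ModuleCat.{u} Q) :
    (tensorResolution P N).opcycles d ⟶ P.complex.opcycles d ⊗ N :=
  (tensorResolution P N).descOpcycles (P.complex.pOpcycles d ▷ N) (d + 1) (by simp) (by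
    change P.complex.d _ _ ▷ N ≫ _ = 0
    rw [← comp_whiskerRight, HomologicalComplex.d_pOpcycles, MonoidalPreadditive.zero_whiskerRight])

theorem p_opcyclesTensorResolution (N : ModuleCat.{u} Q) :
    (tensorResolution P N).pOpcycles d ≫ opcyclesTensorResolution P d N =
      P.complex.pOpcycles d ▷ N :=
  HomologicalComplex.p_descOpcycles _ _ _ _ _

theorem p_opcyclesTensorResolution_apply (N : ModuleCat.{u} Q)
    (w : TensorProduct Q (P.complex.X d) N) :
    (opcyclesTensorResolution P d N).hom (((tensorResolution P N).pOpcycles d).hom w) =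
      (P.complex.pOpcycles d).hom.rTensor N w :=
  congrArg (fun f : (tensorResolution P N).X d ⟶ _ => f.hom w) (p_opcyclesTensorResolution P d N)

/-- Right exactness of `- ⊗ N`: the kernel of `P_d ⊗ N → (P_d / im P_{d+1}) ⊗ N` is the image of
`P_{d+1} ⊗ N`. -/
theorem opcyclesTensorResolution_injective (N : ModuleCat.{u} Q) :
    Function.Injective (opcyclesTensorResolution P d N).hom := by
  rw [← LinearMap.ker_eq_bot, eq_bot_iff]
  intro y hy
  obtain ⟨w, rfl⟩ := (ModuleCat.epi_iff_surjective ((tensorResolution P N).pOpcycles d)).1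
    inferInstance y
  have hw : (P.complex.pOpcycles d).hom.rTensor N w = 0 :=
    (p_opcyclesTensorResolution_apply P d N w).symm.trans hy
  have hex : Function.Exact (P.complex.d (d + 1) d).hom (P.complex.pOpcycles d).hom :=
    (ShortComplex.ShortExact.moduleCat_exact_iff_function_exact
      (ShortComplex.mk _ _ (P.complex.d_pOpcycles (d + 1) d))).1
      (ShortComplex.exact_of_g_is_cokernel _ (P.complex.opcyclesIsCokernel (d + 1) d (by simp)))
  obtain ⟨v, hv⟩ := (rTensor_exact N hex ((ModuleCat.epi_iff_surjective _).1 inferInstance) w).1 hw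
  rw [← hv]
  exact congrArg (fun f => f.hom v) ((tensorResolution P N).d_pOpcycles (d + 1) d)

theorem opcyclesTensorResolution_fromOpcycles (N : ModuleCat.{u} Q) (j : ℕ)
    (y : (tensorResolution P N).opcycles d) :
    (P.complex.fromOpcycles d j).hom.rTensor N ((opcyclesTensorResolution P d N).hom y) =
      ((tensorResolution P N).fromOpcycles d j).hom y := by
  obtain ⟨w, rfl⟩ := (ModuleCat.epi_iff_surjective ((tensorResolution P N).pOpcycles d)).1
    inferInstance y
  have h1 := congrArg (fun f => f.hom w) ((tensorResolution P N).p_fromOpcycles d j)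
  refine Eq.trans ?_ h1.symm
  refine (congrArg _ (p_opcyclesTensorResolution_apply P d N w)).trans ?_
  have h2 : (P.complex.fromOpcycles d j).hom.rTensor N ∘ₗ (P.complex.pOpcycles d).hom.rTensor N =
      (P.complex.d d j).hom.rTensor N := by
    rw [← LinearMap.rTensor_comp, ← ModuleCat.hom_comp, HomologicalComplex.p_fromOpcycles]
  exact LinearMap.congr_fun h2 w

theorem opcyclesTensorResolution_surjective (N : ModuleCat.{u} Q) :
    Function.Surjective (opcyclesTensorResolution P d N).hom := by
  intro y
  obtain ⟨w, hw⟩ := LinearMap.rTensor_surjective N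
    ((ModuleCat.epi_iff_surjective (P.complex.pOpcycles d)).1 inferInstance) y
  exact ⟨((tensorResolution P N).pOpcycles d).hom w,
    (p_opcyclesTensorResolution_apply P d N w).trans hw⟩

/-- The map `P ⊗ N → P ⊗ N'` induced by `N → N'`. -/
noncomputable def tensorResolutionMap {N N' : ModuleCat.{u} Q} (f : N ⟶ N') :
    tensorResolution P N ⟶ tensorResolution P N' :=
  (NatTrans.mapHomologicalComplex ((tensoringRight (ModuleCat.{u} Q)).map f)
    (ComplexShape.down ℕ)).app P.complex

theorem opcyclesTensorResolution_naturality {N N' : ModuleCat.{u} Q} (f : N ⟶ N') :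
    HomologicalComplex.opcyclesMap (tensorResolutionMap P f) d ≫ opcyclesTensorResolution P d N' =
      opcyclesTensorResolution P d N ≫ P.complex.opcycles d ◁ f := by
  refine (cancel_epi ((tensorResolution P N).pOpcycles d)).1 ?_
  rw [HomologicalComplex.p_opcyclesMap_assoc, p_opcyclesTensorResolution, ← Category.assoc,
    p_opcyclesTensorResolution]
  exact whisker_exchange _ _

/-- The isomorphism of `Tor_d(X, N)` with the homology of `P ⊗ N`. -/
noncomputable def torIsoHomology (N : ModuleCat.{u} Q) :
    ((Tor' (ModuleCat.{u} Q) d).obj X).obj N ≅ (tensorResolution P N).homology d :=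
  P.isoLeftDerivedObj ((tensoringRight (ModuleCat.{u} Q)).obj N) d

theorem torIsoHomology_naturality {N N' : ModuleCat.{u} Q} (f : N ⟶ N') :
    ((Tor' (ModuleCat.{u} Q) d).obj X).map f ≫ (torIsoHomology P d N').hom =
      (torIsoHomology P d N).hom ≫
        HomologicalComplex.homologyMap (tensorResolutionMap P f) d := by
  rw [← Iso.eq_comp_inv, Category.assoc]
  exact ProjectiveResolution.leftDerived_app_eq ((tensoringRight (ModuleCat.{u} Q)).map f) P d

/-- The inclusion of `Tor_d(X, N)` into `(P_d / im P_{d+1}) ⊗ N`. -/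
noncomputable def torToOpcyclesTensor (N : ModuleCat.{u} Q) :
    ((Tor' (ModuleCat.{u} Q) d).obj X).obj N ⟶ P.complex.opcycles d ⊗ N :=
  (torIsoHomology P d N).hom ≫ (tensorResolution P N).homologyι d ≫
    opcyclesTensorResolution P d N

theorem torToOpcyclesTensor_naturality {N N' : ModuleCat.{u} Q} (f : N ⟶ N') :
    ((Tor' (ModuleCat.{u} Q) d).obj X).map f ≫ torToOpcyclesTensor P d N' =
      torToOpcyclesTensor P d N ≫ P.complex.opcycles d ◁ f := by
  rw [torToOpcyclesTensor, ← Category.assoc, torIsoHomology_naturality, Category.assoc,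
    HomologicalComplex.homologyι_naturality_assoc, opcyclesTensorResolution_naturality,
    torToOpcyclesTensor, Category.assoc, Category.assoc]

theorem torToOpcyclesTensor_injective (N : ModuleCat.{u} Q) :
    Function.Injective (torToOpcyclesTensor P d N).hom :=
  (opcyclesTensorResolution_injective P d N).comp
    (((ModuleCat.mono_iff_injective ((tensorResolution P N).homologyι d)).1 inferInstance).comp
      (torIsoHomology P d N).toLinearEquiv.injective)

/-- Homology is the kernel of the map from opcycles to the next term; the bijection
`opcyclesTensorResolution` carries this over to `(P_d / im P_{d+1}) ⊗ N`. -/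
theorem torToOpcyclesTensor_exact (N : ModuleCat.{u} Q) :
    Function.Exact (torToOpcyclesTensor P d N).hom
      ((P.complex.fromOpcycles d ((ComplexShape.down ℕ).next d)).hom.rTensor N) := by
  have hex : Function.Exact ((tensorResolution P N).homologyι d).hom
      ((tensorResolution P N).fromOpcycles d ((ComplexShape.down ℕ).next d)).hom :=
    (ShortComplex.ShortExact.moduleCat_exact_iff_function_exact
      (ShortComplex.mk _ _ ((tensorResolution P N).homologyι_comp_fromOpcycles d _))).1
      (ShortComplex.exact_of_f_is_kernel _ ((tensorResolution P N).homologyIsKernel d _ rfl))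
  have hcomm (y) : (P.complex.fromOpcycles d ((ComplexShape.down ℕ).next d)).hom.rTensor N
      ((opcyclesTensorResolution P d N).hom y) =
      ((tensorResolution P N).fromOpcycles d ((ComplexShape.down ℕ).next d)).hom y :=
    opcyclesTensorResolution_fromOpcycles P d N _ y
  intro w
  obtain ⟨y, rfl⟩ := opcyclesTensorResolution_surjective P d N w
  rw [hcomm]
  refine (hex y).trans ?_
  constructor
  · rintro ⟨τ, rfl⟩
    refine ⟨(torIsoHomology P d N).toLinearEquiv.symm τ, ?_⟩
    change (opcyclesTensorResolution P d N).hom (((tensorResolution P N).homologyι d).hom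
      ((torIsoHomology P d N).toLinearEquiv _)) = _
    rw [LinearEquiv.apply_symm_apply]
  · rintro ⟨τ, hτ⟩
    exact ⟨(torIsoHomology P d N).hom.hom τ, opcyclesTensorResolution_injective P d N hτ⟩

/-- If `X` has projective dimension at most `d`, then `Tor_d(X, N)` is naturally isomorphic to
`Hom(Ext^d(X, Q), N)`. -/
theorem exists_torLinearEquiv [IsNoetherianRing Q] [Module.Finite Q X]
    [HasProjectiveDimensionLE X d] :
    ∃ Φ : ∀ N : ModuleCat.{u} Q, ((Tor' (ModuleCat.{u} Q) d).obj X).obj N ≃ₗ[Q]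
        (Ext X (ModuleCat.of Q Q) d →ₗ[Q] N),
      ∀ {N N' : ModuleCat.{u} Q} (f : N ⟶ N') (τ : ((Tor' (ModuleCat.{u} Q) d).obj X).obj N),
        Φ N' ((((Tor' (ModuleCat.{u} Q) d).obj X).map f).hom τ) = f.hom ∘ₗ Φ N τ := by
  obtain ⟨P, hP⟩ := exists_finite_projectiveResolution X
  have : Module.Finite Q (P.complex.opcycles d) :=
    have := hP d
    Module.Finite.of_surjective (P.complex.pOpcycles d).hom
      ((ModuleCat.epi_iff_surjective _).1 inferInstance)
  have : Module.Projective Q (P.complex.opcycles d) :=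
    (IsProjective.iff_projective _).2 (P.projective_opcycles d)
  have := hP ((ComplexShape.down ℕ).next d)
  have : Module.Projective Q (P.complex.X ((ComplexShape.down ℕ).next d)) :=
    (IsProjective.iff_projective _).2 (P.projective _)
  -- One resolution serves all `N`, and the formula `hΦ` determines `Φ N`, so naturality reduces to
  -- that of the contraction.
  choose Φ hΦ using fun N : ModuleCat.{u} Q => exists_linearEquiv_of_ker_rTensor
    (P.complex.fromOpcycles d ((ComplexShape.down ℕ).next d)).hom (opcyclesDualToExt P d)
    (opcyclesDualToExt_surjective P d) (opcyclesDualToExt_eq_zero_iff P d)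
    (torToOpcyclesTensor P d N).hom (torToOpcyclesTensor_injective P d N)
    (torToOpcyclesTensor_exact P d N)
  refine ⟨Φ, fun {N N'} f τ => LinearMap.ext fun e => ?_⟩
  obtain ⟨h, rfl⟩ := opcyclesDualToExt_surjective P d e
  have hnat : (torToOpcyclesTensor P d N').hom ((((Tor' (ModuleCat.{u} Q) d).obj X).map f).hom τ) =
      f.hom.lTensor _ ((torToOpcyclesTensor P d N).hom τ) :=
    congrArg (fun g => g.hom τ) (torToOpcyclesTensor_naturality P d f)
  rw [hΦ, hnat, LinearMap.comp_apply, hΦ, tensorContraction_lTensor]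

end TorHom

/-! ### From `Q`-modules killed by `I` to `Q ⧸ I`-modules. -/

section QuotientFunctors

open MonoidalCategory

variable {Q : Type u} [CommRing Q] (I : Ideal Q)

section Objects

variable {I} {N : ModuleCat.{u} Q} (hN : Module.IsTorsionBySet Q N I) (hfin : Module.Finite Q N)
  (M : FGModuleCat.{u} (Q ⧸ I))

variable {M} in
/-- A `Q`-linear isomorphism between modules killed by `I` is `Q ⧸ I`-linear. -/
noncomputable def toQuotientFGEquiv (e : N ≃ₗ[Q] (quotientToBase I).obj M) :
    toQuotientFG I N hN hfin ≃ₗ[Q ⧸ I] M :=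
  { toFun := e
    invFun := e.symm
    left_inv := e.left_inv
    right_inv := e.right_inv
    map_add' := e.map_add
    map_smul' := by
      intro r x
      obtain ⟨a, rfl⟩ := Ideal.Quotient.mk_surjective r
      exact e.map_smul a x }

/-- Between modules killed by `I`, a `Q`-linear map is `Q ⧸ I`-linear. -/
noncomputable def homToQuotientFG (φ : N →ₗ[Q] (quotientToBase I).obj M) :
    toQuotientFG I N hN hfin →ₗ[Q ⧸ I] M :=
  { toFun := φ
    map_add' := φ.map_add
    map_smul' := by
      intro r x
      obtain ⟨a, rfl⟩ := Ideal.Quotient.mk_surjective r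
      exact φ.map_smul a x }

/-- Between modules killed by `I`, a `Q ⧸ I`-linear map is `Q`-linear. -/
noncomputable def homOfQuotientFG (φ : toQuotientFG I N hN hfin →ₗ[Q ⧸ I] M) :
    N →ₗ[Q] (quotientToBase I).obj M :=
  { toFun := φ
    map_add' := φ.map_add
    map_smul' := fun a x => φ.map_smul (Ideal.Quotient.mk I a) x }

/-- Between modules killed by `I`, the `Q`-linear maps are the `Q ⧸ I`-linear maps. -/
noncomputable def homToQuotientFGEquiv [IsNoetherianRing Q] :
    (N →ₗ[Q] (quotientToBase I).obj M) ≃ₗ[Q]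
      (quotientToBase I).obj ((homFunctor (toQuotientFG I N hN hfin)).obj M) where
  toFun φ := homToQuotientFG hN hfin M φ
  invFun φ := homOfQuotientFG hN hfin M φ
  left_inv _ := rfl
  right_inv _ := rfl
  map_add' _ _ := rfl
  map_smul' _ _ := rfl

/-- Between modules killed by `I`, tensor products over `Q` and over `Q ⧸ I` agree. -/
theorem exists_tensorToQuotientFGEquiv :
    ∃ e : TensorProduct Q N ((quotientToBase I).obj M) ≃ₗ[Q]
      (quotientToBase I).obj (toQuotientFG I N hN hfin ⊗ M), ∀ (x : N) (m : M),
      e (TensorProduct.tmul Q (N := (quotientToBase I).obj M) x m) =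
        TensorProduct.tmul (Q ⧸ I) (M := toQuotientFG I N hN hfin) (N := M) x m := by
  let : Module (Q ⧸ I) N := hN.module
  have : IsScalarTower Q (Q ⧸ I) N := hN.isScalarTower
  let : Module Q M := ((quotientToBase I).obj M).isModule
  have : IsScalarTower Q (Q ⧸ I) M := ⟨fun a r m => by
    obtain ⟨b, rfl⟩ := Ideal.Quotient.mk_surjective r
    exact mul_smul (Ideal.Quotient.mk I a) (Ideal.Quotient.mk I b) m⟩
  -- Scalars of `Q ⧸ I` lift to `Q`, so they already move across the tensor product over `Q`.
  have : TensorProduct.CompatibleSMul Q (Q ⧸ I) N M := ⟨fun r x m => by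
    obtain ⟨b, rfl⟩ := Ideal.Quotient.mk_surjective r
    exact TensorProduct.smul_tmul b x m⟩
  let e := TensorProduct.equivOfCompatibleSMul (Q ⧸ I) Q Q N M
  have he (a : Q) (z : TensorProduct Q N M) : e (a • z) = (Ideal.Quotient.mk I a) • e z := by
    rw [map_smul]
    exact (algebraMap_smul (Q ⧸ I) a (e z)).symm
  exact ⟨{ toFun := e, invFun := e.symm, left_inv := e.left_inv, right_inv := e.right_inv,
           map_add' := e.map_add, map_smul' := he }, fun _ _ => rfl⟩

theorem exists_natural_tensorToQuotientFGEquiv :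
    ∃ e : ∀ M : FGModuleCat.{u} (Q ⧸ I), TensorProduct Q N ((quotientToBase I).obj M) ≃ₗ[Q]
        (quotientToBase I).obj ((tensorLeft (toQuotientFG I N hN hfin)).obj M),
      ∀ {M M' : FGModuleCat.{u} (Q ⧸ I)} (f : M ⟶ M')
        (y : TensorProduct Q N ((quotientToBase I).obj M)),
        e M' (((quotientToBase I).map f).hom.lTensor N y) =
          ((tensorLeft (toQuotientFG I N hN hfin)).map f).hom.hom (e M y) := by
  choose e he using exists_tensorToQuotientFGEquiv hN hfin
  refine ⟨e, fun {M M'} f y => ?_⟩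
  have h : (e M').toLinearMap ∘ₗ ((quotientToBase I).map f).hom.lTensor N =
      ((quotientToBase I).map ((tensorLeft (toQuotientFG I N hN hfin)).map f)).hom ∘ₗ
        (e M).toLinearMap :=
    TensorProduct.ext' fun x m => (he M' x _).trans
      (congrArg ((tensorLeft (toQuotientFG I N hN hfin)).map f).hom.hom (he M x m)).symm
  exact LinearMap.congr_fun h y

end Objects

/-- A functor to `Q`-modules that is isomorphic to a functor `G` to finitely generated
`Q ⧸ I`-modules lifts to a functor isomorphic to `G`. -/
noncomputable def liftToQuotientFGIso {C : Type*} [Category* C] (F : C ⥤ ModuleCat.{u} Q)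
    (hF : ∀ X, Module.IsTorsionBySet Q (F.obj X) I) (hfin : ∀ X, Module.Finite Q (F.obj X))
    (G : C ⥤ FGModuleCat.{u} (Q ⧸ I)) (e : ∀ X, F.obj X ≃ₗ[Q] (quotientToBase I).obj (G.obj X))
    (he : ∀ {X Y : C} (f : X ⟶ Y) (x : F.obj X),
      e Y ((F.map f).hom x) = (G.map f).hom.hom (e X x)) :
    liftToQuotientFG I F hF hfin ≅ G :=
  NatIso.ofComponents
    (fun X => (toQuotientFGEquiv (hF X) (hfin X) (e X)).toFGModuleCatIso)
    (fun f => FGModuleCat.hom_ext (LinearMap.ext fun x => he f x))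

end QuotientFunctors

/-! ### Tensor–Hom adjunction for finitely generated modules. -/

section Adjunction

open MonoidalCategory

variable {R : Type u} [CommRing R] [IsNoetherianRing R] (E : FGModuleCat.{u} R)

/-- Currying of maps out of `E ⊗ M`. -/
noncomputable def homFunctorHomEquiv (M N : FGModuleCat.{u} R) :
    ((tensorLeft E).obj M ⟶ N) ≃ (M ⟶ (homFunctor E).obj N) where
  toFun f := FGModuleCat.ofHom (V := M) (W := E →ₗ[R] N)
    (TensorProduct.curry (M := E) (N := M) f.hom.hom).flip
  invFun g := ObjectProperty.homMk (ModuleCat.ofHom (TensorProduct.lift (M := E) (N := M)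
    (LinearMap.flip (show M →ₗ[R] E →ₗ[R] N from g.hom.hom))))
  left_inv _ := FGModuleCat.hom_ext (TensorProduct.ext' fun _ _ => rfl)
  right_inv _ := FGModuleCat.hom_ext rfl

/-- The adjunction between `E ⊗ -` and `Hom(E, -)`. -/
noncomputable def tensorLeftAdjHomFunctor : tensorLeft E ⊣ homFunctor E :=
  Adjunction.mkOfHomEquiv
    { homEquiv := homFunctorHomEquiv E
      homEquiv_naturality_left_symm := fun _ _ =>
        FGModuleCat.hom_ext (TensorProduct.ext' fun _ _ => rfl)
      homEquiv_naturality_right := fun _ _ =>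
        FGModuleCat.hom_ext (LinearMap.ext fun _ => LinearMap.ext fun _ => rfl) }

end Adjunction

/-! ### The isomorphisms of functors over `Q ⧸ I`, and the theorem. -/

section QuotientRing

variable {Q : Type u} [CommRing Q] [IsNoetherianRing Q] (I : Ideal Q) (d : ℕ)
  [HasProjectiveDimensionLE (ModuleCat.of Q (Q ⧸ I)) d]

/-- If `Q ⧸ I` has projective dimension at most `d` over `Q`, then `Tor_d(Q ⧸ I, -)` is represented
by `Ext^d(Q ⧸ I, Q)`. -/
theorem nonempty_torFunctor_iso : Nonempty (torFunctor I d ≅ homFunctor (extRing I d)) := by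
  have : Module.Finite Q (ModuleCat.of Q (Q ⧸ I)) := inferInstanceAs (Module.Finite Q (Q ⧸ I))
  obtain ⟨Φ, hΦ⟩ := exists_torLinearEquiv (X := ModuleCat.of Q (Q ⧸ I)) d
  refine ⟨liftToQuotientFGIso I _ _ _ _ (fun M => Φ ((quotientToBase I).obj M) ≪≫ₗ
    homToQuotientFGEquiv (extBase_isTorsionBySet I d _)
      (extBase_finite I d _ (inferInstanceAs (Module.Finite Q Q))) M) fun {M M'} f τ => ?_⟩
  refine LinearMap.ext fun e => ?_
  exact LinearMap.congr_fun (hΦ ((quotientToBase I).map f) τ) e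

/-- If `Q ⧸ I` has projective dimension at most `d` over `Q`, then `Ext^d(Q ⧸ I, -)` is the tensor
product with `Ext^d(Q ⧸ I, Q)`. -/
theorem nonempty_extFunctor_iso :
    Nonempty (extFunctor I d ≅ MonoidalCategory.tensorLeft (extRing I d)) := by
  have hfin (M : FGModuleCat.{u} (Q ⧸ I)) := quotientToBase_finite I M
  obtain ⟨t, ht⟩ := exists_natural_tensorToQuotientFGEquiv
    (extBase_isTorsionBySet I d (ModuleCat.of Q Q))
    (extBase_finite I d _ (inferInstanceAs (Module.Finite Q Q)))
  let α (M : FGModuleCat.{u} (Q ⧸ I)) :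
      TensorProduct Q ((extBase I d).obj (ModuleCat.of Q Q)) ((quotientToBase I).obj M) ≃ₗ[Q]
        (quotientToBase I ⋙ extBase I d).obj M :=
    LinearEquiv.ofBijective _
      (lift_extPairing_bijective (ModuleCat.of Q (Q ⧸ I)) d ((quotientToBase I).obj M))
  refine ⟨liftToQuotientFGIso I _ _ _ _ (fun M => (α M).symm ≪≫ₗ t M) fun {M M'} f x => ?_⟩
  obtain ⟨y, rfl⟩ := (α M).surjective x
  have h : ((quotientToBase I ⋙ extBase I d).map f).hom (α M y) =
      α M' (((quotientToBase I).map f).hom.lTensor _ y) :=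
    lift_extPairing_comp_mk₀ (ModuleCat.of Q (Q ⧸ I)) d ((quotientToBase I).map f) y
  have ht' (M) (z) : t M ((α M).symm (α M z)) = t M z := by rw [LinearEquiv.symm_apply_apply]
  rw [h]
  exact (ht' M' _).trans ((ht f y).trans (congrArg
    ((MonoidalCategory.tensorLeft (extRing I d)).map f).hom.hom (ht' M y).symm))

end QuotientRing

theorem proposition4p2 {Q : Type u} [CommRing Q] [IsRegularLocalRing Q] (I : Ideal Q)
    [IsLocalRing (Q ⧸ I)] (n t : ℕ) (hn : ringKrullDim Q = n) (ht : localDepth (Q ⧸ I) = t) :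
    Nonempty (torFunctor I (n - t) ≅ homFunctor (extRing I (n - t))) ∧
    Nonempty (extFunctor I (n - t) ≅ MonoidalCategory.tensorLeft (extRing I (n - t))) ∧
    Nonempty (extFunctor I (n - t) ⊣ torFunctor I (n - t)) ∧
    Nonempty ((extFunctor I (n - t)).obj (FGModuleCat.of (Q ⧸ I) (Q ⧸ I)) ≅
      extRing I (n - t)) := by
  have := hasProjectiveDimensionLE_quotient_of_localDepth I n t hn ht
  obtain ⟨eT⟩ := nonempty_torFunctor_iso I (n - t)
  obtain ⟨eE⟩ := nonempty_extFunctor_iso I (n - t)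
  exact ⟨⟨eT⟩, ⟨eE⟩, ⟨((tensorLeftAdjHomFunctor _).ofNatIsoLeft eE.symm).ofNatIsoRight eT.symm⟩,
    -- `Q ⧸ I` as a module over itself is the tensor unit.
    ⟨eE.app _ ≪≫ MonoidalCategory.rightUnitor (extRing I (n - t))⟩⟩
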